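/- Let $Q\subseteq\mathbb R^n$ be open and consider the fully actuated mechanical system $u=M(q)\ddot q+C(q,\dot q)+G(q)$, where $M$ and $G$ are real analytic on $Q$, $C$ is real analytic on $Q\times\mathbb R^n$, and $M(q)$ is symmetric positive definite for every $q\in Q$. Put $L=M^{-1}$ with columns $\ell_1,\dots,\ell_n$, $x=(q,\dot q)\in Q\times\mathbb R^n$, and $$f(x)=\begin{pmatrix}\dot q\\ -L(q)(C(q,\dot q)+G(q))\end{pmatrix},\qquad g_i(x)=\begin{pmatrix}0\\ \ell_i(q)\end{pmatrix},$$ so that $\dot x=f(x)+\sum_i u_ig_i(x)$. With the Lie bracket $[X,Y]=\frac{\partial Y}{\partial x}X-\frac{\partial X}{\partial x}Y$ write $fg_i=[f,g_i]$, $ffg_i=[f,[f,g_i]]$, $g_ifg_j=[g_i,[f,g_j]]$. The fields $g_ifg_j$ are linear combinations of the $g_k$; let $\alpha_{ijk}(x)$ be the unique functions on $Q\times\mathbb R^n$ with $g_ifg_j=\sum_k\alpha_{ijk}g_k$. For fixed $k$, let $A_k$ be the $(n-1)\times(n-1)$ matrix whose $i$-th column ($i\ne k$) is $(\alpha_{ijk})_{j\ne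 k}$, let $b_{kk}=(\alpha_{ikk})_{i\neq k}$, and let $R_k$ be the set of states $x\in Q\times\mathbb R^n$ at which $\Delta_k=\det A_k\neq0$ and the vectors $g_i$ (all $i$), $fg_i$ and $ffg_i$ ($i\ne k$) span $\mathbb R^{2n}$. Controls are measurable functions on $[0,T]$, $T>0$, with $L_i\le u_i(t)\le M_i$ for almost every $t$, where $L_i,M_i\in\mathbb R$ are constants. An extremal of the time-optimal control problem on $[0,T]$ is a triple $(x,u,\lambda)$ where $u$ is such a control, $x:[0,T]\to Q\times\mathbb R^n$ is an absolutely continuous solution of the dynamics, and $\lambda:[0,T]\to\mathbb R^{2n}$ is an absolutely continuous, nowhere vanishing solution of $\dot\lambda=-\big(\frac{\partial}{\partial x}(f+\sum_iu_ig_i)(x)\big)^{\top}\lambda$ (both equations holding almost everywhere), such that for almost every $t$ the value $u(t)$ maximizes $a\mapsto\langle\lambda(t),f(x(t))+\sum_ia_ig_i(x(t))\rangle-1$ over the box $\prod_i[L_i,M_i]$. Put $\phi_i(t)=\langle\lambda(t),g_i(x(t))\rangle$ and $\psi_k(t)=(\langle\lambda(t),ffg_i(x(t))\rangle)_{i\neq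 k}$. **Theorem.** Let $(x,u,\lambda)$ be an extremal on $[0,T]$, let $k\in\{1,\dots,n\}$, and let $J\subseteq[0,T]$ be an interval with more than one point (for example $J=[0,T]$) such that $\phi_i\equiv0$ on $J$ for every $i\neq k$ (the extremal is $u_i$-singular on $J$ for all $i\ne k$) and $x(t)\in R_k$ for all $t\in J$. Then, after modifying $u$ on a set of measure zero, the following hold on $J$: 1. every $u_i$ is a real analytic function of time on $J$ (at an endpoint of $J$ that belongs to $J$: it extends analytically across it); 2. $u_k$ is equal to a constant $c_k\in\{L_k,M_k\}$ on $J$; 3. for every $t\in J$ the vector $\bar u(t)=(u_i(t))_{i\ne k}$ is the unique solution $\bar w\in\mathbb R^{n-1}$ of the linear equation $$\psi_k(t)+b_{kk}(x(t))\,c_k\,\phi_k(t)+\bar w^{\top}A_k(x(t))\,\phi_k(t)=0 .$$ -/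

import Mathlib

open Set MeasureTheory Matrix

/-- States `x = (q, q̇)`, costates and tangent vectors, all elements of `ℝ^{2n} = ℝ^n × ℝ^n`. -/
abbrev PhaseSpace (n : ℕ) : Type := (Fin n → ℝ) × (Fin n → ℝ)

/-- The Euclidean pairing `⟨p, w⟩` on `ℝ^{2n}`. -/
def pairing {n : ℕ} (p w : PhaseSpace n) : ℝ := p.1 ⬝ᵥ w.1 + p.2 ⬝ᵥ w.2

/-- A fully actuated mechanical system `u = M(q) q̈ + C(q, q̇) + G(q)` with real analytic data on an
open set `Q` of configurations. -/
structure MechanicalSystem (n : ℕ) where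
  Q : Set (Fin n → ℝ)
  M : (Fin n → ℝ) → Matrix (Fin n) (Fin n) ℝ
  C : (Fin n → ℝ) → (Fin n → ℝ) → (Fin n → ℝ)
  G : (Fin n → ℝ) → (Fin n → ℝ)
  isOpen_Q : IsOpen Q
  posDef_M : ∀ q ∈ Q, (M q).PosDef
  analytic_M : ∀ i j, AnalyticOnNhd ℝ (fun q => M q i j) Q
  analytic_C : AnalyticOnNhd ℝ (fun y : PhaseSpace n => C y.1 y.2) (Q ×ˢ univ)
  analytic_G : AnalyticOnNhd ℝ G Q

namespace MechanicalSystem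

variable {n : ℕ} (S : MechanicalSystem n)

/-- `L(q) = M(q)⁻¹`. -/
noncomputable def L (q : Fin n → ℝ) : Matrix (Fin n) (Fin n) ℝ := (S.M q)⁻¹

/-- The drift `f(q, q̇) = (q̇, -L(q) (C(q, q̇) + G(q)))`. -/
noncomputable def f (y : PhaseSpace n) : PhaseSpace n :=
  (y.2, -(S.L y.1 *ᵥ (S.C y.1 y.2 + S.G y.1)))

/-- The control field `g_i(q, q̇) = (0, ℓ_i(q))`, with `ℓ_i` the `i`-th column of `L`. -/
noncomputable def g (i : Fin n) (y : PhaseSpace n) : PhaseSpace n :=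
  (0, fun r => S.L y.1 r i)

/-- The right-hand side `f(x) + g(x) a` for the control value `a`. -/
noncomputable def rhs (a : Fin n → ℝ) (y : PhaseSpace n) : PhaseSpace n :=
  S.f y + ∑ i, a i • S.g i y

/-- The bracket `fg_i = [f, g_i]`. (Mathlib's convention is `[V, W] = W' V - V' W`.) -/
noncomputable def fg (i : Fin n) : PhaseSpace n → PhaseSpace n :=
  VectorField.lieBracket ℝ S.f (S.g i)

/-- The bracket `ffg_i = [f, [f, g_i]]`. -/
noncomputable def ffg (i : Fin n) : PhaseSpace n → PhaseSpace n :=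
  VectorField.lieBracket ℝ S.f (S.fg i)

/-- The bracket `g_i fg_j = [g_i, [f, g_j]]`. -/
noncomputable def gfg (i j : Fin n) : PhaseSpace n → PhaseSpace n :=
  VectorField.lieBracket ℝ (S.g i) (S.fg j)

/-- The coefficients `α_{ijk}` of `g_i fg_j` in the frame `g_1, …, g_n`: as `g_k = (0, L e_k)`,
they are the entries of `M(q)` times the velocity part of `g_i fg_j`
(see `gfg_eq_sum_alpha` and `alpha_unique`). -/
noncomputable def alpha (i j k : Fin n) (y : PhaseSpace n) : ℝ :=
  (S.M y.1 *ᵥ (S.gfg i j y).2) k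

/-- The matrix `A_k`, whose `i`-th column (`i ≠ k`) is `(α_{ijk})_{j ≠ k}`. -/
noncomputable def A (k : Fin n) (y : PhaseSpace n) :
    Matrix {i : Fin n // i ≠ k} {i : Fin n // i ≠ k} ℝ :=
  Matrix.of fun j i => S.alpha i j k y

/-- The vector `b_{kk} = (α_{ikk})_{i ≠ k}`. -/
noncomputable def b (k : Fin n) (y : PhaseSpace n) : {i : Fin n // i ≠ k} → ℝ :=
  fun i => S.alpha i k k y

/-- The set `S_k` of states at which the `g_i` (all `i`) and the `fg_i`, `ffg_i` (`i ≠ k`) span the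
tangent space. -/
def spanRegion (k : Fin n) : Set (PhaseSpace n) :=
  {y | y.1 ∈ S.Q ∧
    Submodule.span ℝ ({w | ∃ i, w = S.g i y} ∪ {w | ∃ i, i ≠ k ∧ w = S.fg i y} ∪
      {w | ∃ i, i ≠ k ∧ w = S.ffg i y}) = ⊤}

/-- `R_k = S_k ∩ {x | Δ_k(x) ≠ 0}` with `Δ_k = det A_k`. -/
def region (k : Fin n) : Set (PhaseSpace n) :=
  S.spanRegion k ∩ {y | (S.A k y).det ≠ 0}

/-- The Hamiltonian `H(x, a, p) = ⟨p, f(x) + g(x) a⟩ - 1`. -/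
noncomputable def hamiltonian (y : PhaseSpace n) (a : Fin n → ℝ) (p : PhaseSpace n) : ℝ :=
  pairing p (S.rhs a y) - 1

/-- The switching function `φ_i = ⟨p, g_i(x)⟩`. -/
noncomputable def switching (i : Fin n) (y p : PhaseSpace n) : ℝ := pairing p (S.g i y)

/-- The vector `ψ_k = (⟨p, ffg_i(x)⟩)_{i ≠ k}`. -/
noncomputable def psi (k : Fin n) (y p : PhaseSpace n) : {i : Fin n // i ≠ k} → ℝ :=
  fun i => pairing p (S.ffg i y)

/-- `(x, u, p)` is an extremal on `[0, T]` of the time-optimal control problem with the control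
bounds `lo i ≤ u i ≤ hi i`: `u` is an admissible measurable control, `x` is a Carathéodory solution
of the dynamics, `p` is a nowhere vanishing Carathéodory solution of the adjoint equation
`ṗ = -(∂(f + g u)/∂x)ᵀ p`, and `u` maximizes the Hamiltonian almost everywhere. -/
structure IsExtremal (lo hi : Fin n → ℝ) (T : ℝ) (x : ℝ → PhaseSpace n) (u : ℝ → Fin n → ℝ)
    (p : ℝ → PhaseSpace n) : Prop where
  T_pos : 0 < T
  measurable_u : AEMeasurable u (volume.restrict (Icc 0 T))
  u_mem : ∀ᵐ t ∂volume.restrict (Icc 0 T), u t ∈ Icc lo hi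
  x_mem : ∀ t ∈ Icc 0 T, (x t).1 ∈ S.Q
  x_ac : AbsolutelyContinuousOnInterval x 0 T
  x_deriv : ∀ᵐ t ∂volume.restrict (Icc 0 T), HasDerivAt x (S.rhs (u t) (x t)) t
  p_ne_zero : ∀ t ∈ Icc 0 T, p t ≠ 0
  p_ac : AbsolutelyContinuousOnInterval p 0 T
  p_deriv : ∀ᵐ t ∂volume.restrict (Icc 0 T), ∃ p' : PhaseSpace n, HasDerivAt p p' t ∧
    ∀ w, pairing p' w = -pairing (p t) (fderiv ℝ (S.rhs (u t)) (x t) w)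
  max_hamiltonian : ∀ᵐ t ∂volume.restrict (Icc 0 T),
    IsMaxOn (fun a => S.hamiltonian (x t) a (p t)) (Icc lo hi) (u t)

/-! Helper facts: the `α_{ijk}` are the coefficients of `g_i fg_j` in the `g_k`. -/

theorem differentiableAt_det {E : Type*} [NormedAddCommGroup E] [NormedSpace ℝ E]
    {B : E → Matrix (Fin n) (Fin n) ℝ} {y : E}
    (hB : ∀ i j, DifferentiableAt ℝ (fun z => B z i j) y) :
    DifferentiableAt ℝ (fun z => (B z).det) y := by
  simp only [Matrix.det_apply]
  refine DifferentiableAt.fun_sum fun σ _ => DifferentiableAt.const_smul ?_ _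
  exact (HasFDerivAt.finsetProd fun i _ => (hB (σ i) i).hasFDerivAt).differentiableAt

theorem differentiableAt_L {q : Fin n → ℝ} (hq : q ∈ S.Q) (i j : Fin n) :
    DifferentiableAt ℝ (fun z => S.L z i j) q := by
  have hM : ∀ i j, DifferentiableAt ℝ (fun z => S.M z i j) q := fun i j =>
    (S.analytic_M i j q hq).differentiableAt
  have h : (fun z => S.L z i j) = fun z => (S.M z).det⁻¹ * ((S.M z).updateRow j (Pi.single i 1)).det := by
    funext z
    simp [L, Matrix.inv_def, Matrix.adjugate_apply, Ring.inverse_eq_inv']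
  rw [h]
  refine ((differentiableAt_det hM).inv (S.posDef_M q hq).det_pos.ne').mul (differentiableAt_det ?_)
  intro r s
  by_cases hr : r = j
  · subst hr; simp
  · simpa [Matrix.updateRow_ne hr] using hM r s

theorem differentiableAt_g {y : PhaseSpace n} (hy : y.1 ∈ S.Q) (i : Fin n) :
    DifferentiableAt ℝ (S.g i) y := by
  refine (differentiableAt_const _).prodMk (differentiableAt_pi.2 fun r => ?_)
  exact (S.differentiableAt_L hy r i).comp y differentiableAt_fst

theorem differentiableAt_f {y : PhaseSpace n} (hy : y.1 ∈ S.Q) : DifferentiableAt ℝ S.f y := by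
  refine differentiableAt_snd.prodMk (DifferentiableAt.neg (differentiableAt_pi.2 fun r => ?_))
  have hC := (S.analytic_C y ⟨hy, mem_univ _⟩).differentiableAt
  have hG : DifferentiableAt ℝ (fun z : PhaseSpace n => S.G z.1) y :=
    (S.analytic_G y.1 hy).differentiableAt.comp y differentiableAt_fst
  simp only [Matrix.mulVec, dotProduct, Pi.add_apply]
  refine DifferentiableAt.fun_sum fun s _ => DifferentiableAt.mul ?_ ?_
  · exact (S.differentiableAt_L hy r s).comp y differentiableAt_fst
  · exact (differentiableAt_pi.1 hC s).add (differentiableAt_pi.1 hG s)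

theorem fderiv_g_fst {y : PhaseSpace n} (hy : y.1 ∈ S.Q) (i : Fin n) (w : PhaseSpace n) :
    (fderiv ℝ (S.g i) y w).1 = 0 := by
  have h := ((S.differentiableAt_g hy i).hasFDerivAt).fst
  have h0 : HasFDerivAt (fun z => (S.g i z).1) (0 : PhaseSpace n →L[ℝ] (Fin n → ℝ)) y :=
    hasFDerivAt_const (0 : Fin n → ℝ) y
  simpa using DFunLike.congr_fun (h.unique h0) w

theorem fderiv_f_fst {y : PhaseSpace n} (hy : y.1 ∈ S.Q) (w : PhaseSpace n) :
    (fderiv ℝ S.f y w).1 = w.2 := by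
  have h := ((S.differentiableAt_f hy).hasFDerivAt).fst
  have h0 : HasFDerivAt (fun z => (S.f z).1) (ContinuousLinearMap.snd ℝ (Fin n → ℝ) (Fin n → ℝ)) y :=
    hasFDerivAt_snd
  simpa using DFunLike.congr_fun (h.unique h0) w

theorem fg_fst {y : PhaseSpace n} (hy : y.1 ∈ S.Q) (i : Fin n) :
    (S.fg i y).1 = -fun r => S.L y.1 r i := by
  simp only [fg, VectorField.lieBracket, Prod.fst_sub, S.fderiv_g_fst hy, S.fderiv_f_fst hy, zero_sub]
  rfl

theorem gfg_fst {y : PhaseSpace n} (hy : y.1 ∈ S.Q) (i j : Fin n) : (S.gfg i j y).1 = 0 := by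
  simp only [gfg, VectorField.lieBracket, Prod.fst_sub, S.fderiv_g_fst hy, sub_zero]
  by_cases hd : DifferentiableAt ℝ (S.fg j) y
  · have h := hd.hasFDerivAt.fst
    have hc : HasFDerivAt (fun z => fun r => S.L z r j)
        (fderiv ℝ (fun z => fun r => S.L z r j) y.1) y.1 :=
      (differentiableAt_pi.2 fun r => S.differentiableAt_L hy r j).hasFDerivAt
    have hcomp := (hc.comp y (hasFDerivAt_fst (𝕜 := ℝ) (p := y))).neg
    have he : (fun z => (S.fg j z).1) =ᶠ[nhds y] fun z => -fun r => S.L z.1 r j := by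
      filter_upwards [(S.isOpen_Q.preimage continuous_fst).mem_nhds hy] with z hz
      exact S.fg_fst hz j
    have := DFunLike.congr_fun (h.unique (hcomp.congr_of_eventuallyEq he)) (S.g i y)
    simpa [g] using this
  · rw [fderiv_zero_of_not_differentiableAt hd]; rfl

theorem sum_smul_g (c : Fin n → ℝ) (y : PhaseSpace n) :
    ∑ k, c k • S.g k y = (0, S.L y.1 *ᵥ c) := by
  refine Prod.ext ?_ ?_
  · simp [Prod.fst_sum, g]
  · funext r
    simp [Prod.snd_sum, g, Matrix.mulVec, dotProduct, mul_comm]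

theorem gfg_eq_sum_alpha {y : PhaseSpace n} (hy : y.1 ∈ S.Q) (i j : Fin n) :
    S.gfg i j y = ∑ k, S.alpha i j k y • S.g k y := by
  have hu : IsUnit (S.M y.1).det := (S.posDef_M _ hy).det_pos.ne'.isUnit
  rw [S.sum_smul_g (fun k => S.alpha i j k y)]
  refine Prod.ext (S.gfg_fst hy i j) ?_
  change _ = S.L y.1 *ᵥ (S.M y.1 *ᵥ (S.gfg i j y).2)
  rw [L, Matrix.mulVec_mulVec, Matrix.nonsing_inv_mul _ hu, Matrix.one_mulVec]

theorem alpha_unique {y : PhaseSpace n} (hy : y.1 ∈ S.Q) (i j : Fin n) (c : Fin n → ℝ)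
    (hc : S.gfg i j y = ∑ k, c k • S.g k y) (k : Fin n) : c k = S.alpha i j k y := by
  have hu : IsUnit (S.M y.1).det := (S.posDef_M _ hy).det_pos.ne'.isUnit
  rw [alpha, hc, S.sum_smul_g, L, Matrix.mulVec_mulVec, Matrix.mul_nonsing_inv _ hu,
    Matrix.one_mulVec]

end MechanicalSystem

/-! Along an extremal, `⟨p, X(x)⟩` has derivative `⟨p, [f, X]⟩ + ∑ u_j ⟨p, [g_j, X]⟩` almost
everywhere. The `g_i` depend on `q` alone and are vertical, so they commute. Hence differentiating
`φ_i = 0` (`i ≠ k`) gives `⟨p, fg_i⟩ = 0`, without controls, and differentiating again gives `⟨p,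
ffg_i⟩ + φ_k ∑ u_j α_{ijk} = 0` almost everywhere, since only the `g_k` component of a bracket pairs
nontrivially with `p`. If `φ_k` vanished at some time, boundedness of `u` would force `⟨p, ffg_i⟩ =
0` there, and the spanning condition would give `p = 0` (`IsExtremal.switching_ne_zero`). So `φ_k`
has constant sign, and the maximum condition puts `u_k` at one fixed bound. As `det A_k ≠ 0`, the
remaining controls solve the linear system: `u` is an analytic feedback of `(x, p)` almost
everywhere (`IsExtremal.ae_eq_feedback`). Substituting the feedback, `(x, p)` solves an autonomous
analytic equation almost everywhere, hence classically by absolute continuity. The analytic Cauchy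
theorem (`AnalyticAt.exists_analyticAt_hasDerivAt`) together with local uniqueness makes `(x, p)`,
and so `u`, analytic up to and across the endpoints belonging to `J`. -/

/-! ### Analytic Cauchy theorem by majorization of the formal solution. -/

section PowerSeriesODE

variable {E : Type*} [NormedAddCommGroup E] [NormedSpace ℝ E]

/-- The Taylor coefficients of the solution of `y' = F(y)`, `y(0) = z₀`, where `p` is the power
series of `F` at `z₀`. -/
noncomputable def odeCoeff (p : FormalMultilinearSeries ℝ E E) (z₀ : E) : ℕ → E
  | 0 => z₀
  | m + 1 => ((m : ℝ) + 1)⁻¹ •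
      ∑ c : Composition m, p c.length fun i => odeCoeff p z₀ (c.blocksFun i)
  decreasing_by exact Nat.lt_succ_of_le (c.blocksFun_le i)

/-- The power series with coefficients `odeCoeff`. -/
noncomputable def odeSeries (p : FormalMultilinearSeries ℝ E E) (z₀ : E) :
    FormalMultilinearSeries ℝ ℝ E :=
  fun m => ContinuousMultilinearMap.mkPiRing ℝ (Fin m) (odeCoeff p z₀ m)

variable {p : FormalMultilinearSeries ℝ E E} {z₀ : E}

theorem odeSeries_coeff (m : ℕ) : (odeSeries p z₀).coeff m = odeCoeff p z₀ m := by
  simp [odeSeries, FormalMultilinearSeries.coeff]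

theorem odeCoeff_succ (m : ℕ) : odeCoeff p z₀ (m + 1) = ((m : ℝ) + 1)⁻¹ •
    ∑ c : Composition m, p c.length fun i => odeCoeff p z₀ (c.blocksFun i) := by
  rw [odeCoeff]

/-- This identifies the recursion for `odeCoeff` as comparison of coefficients in `y' = F(y)`.
Blocks of a composition are positive, so the constant term `z₀` never enters the sum. -/
theorem coeff_comp_odeSeries (m : ℕ) :
    (p.comp (odeSeries p z₀)).coeff m =
      ∑ c : Composition m, p c.length fun i => odeCoeff p z₀ (c.blocksFun i) := by
  simp only [FormalMultilinearSeries.coeff, FormalMultilinearSeries.comp,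
    _root_.sum_apply, FormalMultilinearSeries.compAlongComposition_apply]
  refine Finset.sum_congr rfl fun c _ => congrArg _ (funext fun i => ?_)
  simp [FormalMultilinearSeries.applyComposition, odeSeries]

/-- Expanding the `j`-th power gives one term for each `j`-tuple of blocks in `[1, N]`. Every
composition of some `k ≤ N` is such a tuple with `j ≤ N`, and the surplus terms are nonnegative. -/
theorem sum_range_composition_le (N : ℕ) {q : ℕ → ℝ} (hq : ∀ k, 0 ≤ q k) {r a : ℝ} (hr : 0 ≤ r)
    (ha : 0 ≤ a) :
    ∑ k ∈ Finset.range (N + 1), a ^ k * ∑ c : Composition k, r ^ c.length * ∏ j, q (c.blocksFun j) ≤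
      ∑ j ∈ Finset.range (N + 1), (r * ∑ k ∈ Finset.Ico 1 (N + 1), a ^ k * q k) ^ j :=
  calc
    _ = ∑ k ∈ Finset.range (N + 1), ∑ c : Composition k,
          ∏ j, r * (a ^ c.blocksFun j * q (c.blocksFun j)) := by
      simp_rw [Finset.mul_sum]
      congr! with k _ c
      rw [Finset.prod_mul_distrib, Finset.prod_mul_distrib, Finset.prod_pow_eq_pow_sum,
        Composition.sum_blocksFun, Finset.prod_const, Finset.card_fin]
      ring
    _ ≤ ∑ d ∈ FormalMultilinearSeries.compPartialSumTarget 0 (N + 1) (N + 1),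
          ∏ j : Fin d.2.length, r * (a ^ d.2.blocksFun j * q (d.2.blocksFun j)) := by
      rw [Finset.sum_sigma']
      refine Finset.sum_le_sum_of_subset_of_nonneg ?_ fun x _ _ =>
        Finset.prod_nonneg fun j _ => mul_nonneg hr (mul_nonneg (pow_nonneg ha _) (hq _))
      rintro ⟨k, c⟩ hd
      simp only [Finset.mem_sigma, Finset.mem_range, Finset.mem_univ, and_true] at hd
      simp only [FormalMultilinearSeries.mem_compPartialSumTarget_iff]
      exact ⟨Nat.zero_le _, c.length_le.trans_lt hd, fun j => (c.blocksFun_le j).trans_lt hd⟩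
    _ = ∑ e ∈ FormalMultilinearSeries.compPartialSumSource 0 (N + 1) (N + 1),
          ∏ j : Fin e.1, r * (a ^ e.2 j * q (e.2 j)) := by
      symm
      apply FormalMultilinearSeries.compChangeOfVariables_sum
      rintro ⟨k, blocksFun⟩ H
      have K : (FormalMultilinearSeries.compChangeOfVariables 0 (N + 1) (N + 1)
        ⟨k, blocksFun⟩ H).snd.length = k := by simp
      congr 2 <;> try rw [K]
      rw [Fin.heq_fun_iff K.symm]
      intro j
      rw [FormalMultilinearSeries.compChangeOfVariables_blocksFun]
    _ = _ := by
      rw [FormalMultilinearSeries.compPartialSumSource,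
        ← Finset.sum_sigma' (Finset.Ico 0 (N + 1))
          (fun k : ℕ => (Fintype.piFinset fun _ : Fin k => Finset.Ico 1 (N + 1) :
            Finset (Fin k → ℕ)))
          (fun n e => ∏ j : Fin n, r * (a ^ e j * q (e j))), ← Finset.range_eq_Ico]
      refine Finset.sum_congr rfl fun j _ => ?_
      rw [Finset.mul_sum, Finset.sum_pow']

/-- Write `s_N` for the weighted partial sum. The recursion yields `s_{N+1} ≤ a C ∑ (r s_N)^j`. If
`r s_N ≤ 1/2`, the geometric sum is at most `2`, and `2 a C ≤ 1 / (2 r)` closes the induction. -/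
theorem sum_odeCoeff_le {C r a : ℝ} (hC : 0 ≤ C) (hr : 0 < r) (ha : 0 ≤ a)
    (haC : 4 * a * C * r ≤ 1) (hp : ∀ n, ‖p n‖ ≤ C * r ^ n) (N : ℕ) :
    ∑ k ∈ Finset.Ico 1 (N + 1), a ^ k * ‖odeCoeff p z₀ k‖ ≤ 1 / (2 * r) := by
  induction N with
  | zero => simp; positivity
  | succ N ih =>
    have hterm (m : ℕ) : a ^ (m + 1) * ‖odeCoeff p z₀ (m + 1)‖ ≤
        a * C * (a ^ m * ∑ c : Composition m,
          r ^ c.length * ∏ j, ‖odeCoeff p z₀ (c.blocksFun j)‖) := by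
      have h1 : ‖odeCoeff p z₀ (m + 1)‖ ≤ C * ∑ c : Composition m,
          r ^ c.length * ∏ j, ‖odeCoeff p z₀ (c.blocksFun j)‖ := by
        rw [odeCoeff_succ, norm_smul, Finset.mul_sum]
        have h2 : ‖((m : ℝ) + 1)⁻¹‖ ≤ 1 := by
          rw [norm_inv, Real.norm_of_nonneg (by positivity)]
          exact inv_le_one_of_one_le₀ (by linarith [m.cast_nonneg (α := ℝ)])
        refine (mul_le_of_le_one_left (norm_nonneg _) h2).trans ((norm_sum_le _ _).trans ?_)
        refine Finset.sum_le_sum fun c _ => ?_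
        rw [← mul_assoc]
        refine ((p c.length).le_opNorm _).trans ?_
        gcongr
        exact hp _
      calc a ^ (m + 1) * ‖odeCoeff p z₀ (m + 1)‖ ≤ a ^ (m + 1) * _ :=
            mul_le_mul_of_nonneg_left h1 (pow_nonneg ha _)
        _ = _ := by ring
    have hx0 : 0 ≤ r * ∑ k ∈ Finset.Ico 1 (N + 1), a ^ k * ‖odeCoeff p z₀ k‖ :=
      mul_nonneg hr.le (Finset.sum_nonneg fun k _ => by positivity)
    have hx : r * ∑ k ∈ Finset.Ico 1 (N + 1), a ^ k * ‖odeCoeff p z₀ k‖ ≤ 1 / 2 :=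
      (mul_le_mul_of_nonneg_left ih hr.le).trans_eq (by field_simp)
    have hgeom : ∑ j ∈ Finset.range (N + 1),
        (r * ∑ k ∈ Finset.Ico 1 (N + 1), a ^ k * ‖odeCoeff p z₀ k‖) ^ j ≤ 2 :=
      (Finset.sum_le_sum fun j _ => pow_le_pow_left₀ hx0 hx j).trans
        (sum_geometric_two_le _)
    calc ∑ k ∈ Finset.Ico 1 (N + 1 + 1), a ^ k * ‖odeCoeff p z₀ k‖
        = ∑ m ∈ Finset.range (N + 1), a ^ (m + 1) * ‖odeCoeff p z₀ (m + 1)‖ := by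
          rw [Finset.sum_Ico_eq_sum_range]
          simp [add_comm]
      _ ≤ ∑ m ∈ Finset.range (N + 1), a * C * (a ^ m * ∑ c : Composition m,
          r ^ c.length * ∏ j, ‖odeCoeff p z₀ (c.blocksFun j)‖) :=
          Finset.sum_le_sum fun m _ => hterm m
      _ ≤ a * C * 2 := by
          rw [← Finset.mul_sum]
          exact mul_le_mul_of_nonneg_left ((sum_range_composition_le N
            (fun k => norm_nonneg _) hr.le ha).trans hgeom) (mul_nonneg ha hC)
      _ ≤ 1 / (2 * r) := by
          rw [le_div_iff₀ (by positivity)]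
          linarith

theorem odeSeries_radius_pos (hp : 0 < p.radius) : 0 < (odeSeries p z₀).radius := by
  obtain ⟨C, r, hC, hr, hle⟩ := p.le_mul_pow_of_radius_pos hp
  -- The equality case of the smallness condition `4 a C r ≤ 1`.
  set a : ℝ := 1 / (4 * C * r) with ha
  have ha0 : 0 < a := by positivity
  have haC : 4 * a * C * r ≤ 1 := by rw [ha]; field_simp; rfl
  have hbound (n : ℕ) : ‖odeSeries p z₀ n‖ * (⟨a, ha0.le⟩ : NNReal) ^ n ≤
      max ‖z₀‖ (1 / (2 * r)) := by
    rw [odeSeries, ContinuousMultilinearMap.norm_mkPiRing, mul_comm]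
    rcases n with _ | n
    · simp [odeCoeff]
    · refine le_max_of_le_right (le_trans ?_
        (sum_odeCoeff_le (z₀ := z₀) hC.le hr ha0.le haC hle (n + 1)))
      exact Finset.single_le_sum (f := fun k => a ^ k * ‖odeCoeff p z₀ k‖)
        (fun k _ => by positivity) (Finset.mem_Ico.2 ⟨by omega, by omega⟩)
  exact lt_of_lt_of_le (ENNReal.coe_pos.2 (show (0 : NNReal) < ⟨a, ha0.le⟩ from ha0))
    ((odeSeries p z₀).le_radius_of_bound _ hbound)

/-- An autonomous equation with analytic right-hand side has an analytic local solution. -/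
theorem AnalyticAt.exists_analyticAt_hasDerivAt [CompleteSpace E] {F : E → E}
    (hF : AnalyticAt ℝ F z₀) (t₀ : ℝ) : ∃ y : ℝ → E, AnalyticAt ℝ y t₀ ∧ y t₀ = z₀ ∧
      ∀ᶠ t in nhds t₀, HasDerivAt y (F (y t)) t := by
  suffices h : ∃ y : ℝ → E, AnalyticAt ℝ y 0 ∧ y 0 = z₀ ∧
      ∀ᶠ t in nhds 0, HasDerivAt y (F (y t)) t by
    obtain ⟨y, hy, hy0, hd⟩ := h
    have hsub : Filter.Tendsto (fun t => t - t₀) (nhds t₀) (nhds 0) := by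
      simpa using (continuous_sub_right t₀).tendsto t₀
    refine ⟨fun t => y (t - t₀), ?_, by simpa using hy0, ?_⟩
    · exact AnalyticAt.fun_comp (by simpa using hy) (analyticAt_id.sub analyticAt_const)
    · filter_upwards [hsub.eventually hd] with t ht
      exact ht.comp_sub_const t t₀
  obtain ⟨p, hp⟩ := hF
  have hball := (odeSeries p z₀).hasFPowerSeriesOnBall (odeSeries_radius_pos (z₀ := z₀) hp.radius_pos)
  set y := (odeSeries p z₀).sum with hy
  have hy0 : y 0 = z₀ := by
    rw [← hball.coeff_zero (fun _ => 0)]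
    simp [odeSeries, odeCoeff]
  have hcomp : HasFPowerSeriesAt (F ∘ y) (p.comp (odeSeries p z₀)) 0 :=
    HasFPowerSeriesAt.comp (by rwa [hy0]) hball.hasFPowerSeriesAt
  have hder : HasFPowerSeriesAt (fun t => fderiv ℝ y t 1)
      ((ContinuousLinearMap.apply ℝ E (1 : ℝ)).compFormalMultilinearSeries
        (odeSeries p z₀).derivSeries) 0 :=
    ((ContinuousLinearMap.apply ℝ E (1 : ℝ)).comp_hasFPowerSeriesOnBall
      hball.fderiv).hasFPowerSeriesAt
  -- The `m`-th coefficient of `y'` is `m + 1` times the coefficient of `y` at `m + 1`, which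
  -- cancels the factor `(m + 1)⁻¹` in the recursion.
  have heq : (ContinuousLinearMap.apply ℝ E (1 : ℝ)).compFormalMultilinearSeries
        (odeSeries p z₀).derivSeries = p.comp (odeSeries p z₀) := by
    refine funext fun m => ?_
    refine (FormalMultilinearSeries.mkPiRing_coeff_eq _ m).symm.trans
      (Eq.trans (congrArg _ ?_) (FormalMultilinearSeries.mkPiRing_coeff_eq _ m))
    have : ((ContinuousLinearMap.apply ℝ E (1 : ℝ)).compFormalMultilinearSeries
        (odeSeries p z₀).derivSeries).coeff m = (odeSeries p z₀).derivSeries.coeff m 1 := rfl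
    rw [this, FormalMultilinearSeries.derivSeries_coeff_one, odeSeries_coeff, odeCoeff_succ,
      coeff_comp_odeSeries, ← Nat.cast_smul_eq_nsmul ℝ, smul_smul]
    push_cast
    rw [mul_inv_cancel₀ (by positivity), one_smul]
  rw [heq] at hder
  have hya : AnalyticAt ℝ y 0 := hball.analyticAt
  refine ⟨y, hya, hy0, ?_⟩
  have hzero : ∀ᶠ t in nhds (0 : ℝ), fderiv ℝ y t 1 = (F ∘ y) t := by
    have h := hder.sub hcomp
    rw [sub_self] at h
    filter_upwards [h.eventually_eq_zero] with t ht
    exact sub_eq_zero.1 ht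
  filter_upwards [hzero, hya.eventually_analyticAt] with t ht hta
  have := hta.differentiableAt.hasDerivAt
  rwa [← fderiv_apply_one_eq_deriv, ht] at this

end PowerSeriesODE

/-! ### Solutions, analytic extensions and almost-everywhere arguments on an interval. -/

section IntervalODE

variable {E : Type*} [NormedAddCommGroup E] [NormedSpace ℝ E] {J : Set ℝ}

/-- A solution on an interval agrees near each time with an analytic function. -/
theorem exists_analyticAt_eventually_eq [CompleteSpace E] {F : E → E} {z : ℝ → E}
    (hJ : J.OrdConnected) (hz : ∀ t ∈ J, HasDerivWithinAt z (F (z t)) J t) {t₀ : ℝ} (ht₀ : t₀ ∈ J)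
    (hF : AnalyticAt ℝ F (z t₀)) :
    ∃ y : ℝ → E, AnalyticAt ℝ y t₀ ∧ ∀ᶠ t in nhds t₀, t ∈ J → z t = y t := by
  obtain ⟨y, hya, hy0, hyd⟩ := hF.exists_analyticAt_hasDerivAt t₀
  refine ⟨y, hya, ?_⟩
  -- Analyticity makes `F` Lipschitz near `z t₀`, which gives uniqueness. The two sides of `t₀` are
  -- treated separately because `t₀` may be an endpoint of `J`.
  obtain ⟨K, s, hs, hK⟩ := (hF.contDiffAt (n := 1)).exists_lipschitzOnWith
  have hzs : ∀ᶠ t in nhds t₀, t ∈ J → z t ∈ s :=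
    eventually_nhdsWithin_iff.1 ((hz t₀ ht₀).continuousWithinAt.eventually hs)
  have hys : ∀ᶠ t in nhds t₀, y t ∈ s := hya.continuousAt.eventually (by rwa [hy0])
  obtain ⟨ε, hε, hball⟩ := Metric.eventually_nhds_iff_ball.1 (hyd.and (hzs.and hys))
  rw [Real.ball_eq_Ioo] at hball
  filter_upwards [Ioo_mem_nhds (sub_lt_self t₀ hε) (lt_add_of_pos_right t₀ hε)] with t ht htJ
  rcases le_total t₀ t with h | h
  · have hsub : Icc t₀ t ⊆ J := hJ.out ht₀ htJ
    have hsub' : Icc t₀ t ⊆ Ioo (t₀ - ε) (t₀ + ε) := fun τ hτ =>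
      ⟨by linarith [hτ.1], hτ.2.trans_lt ht.2⟩
    refine ODE_solution_unique_of_mem_Icc_right (v := fun _ => F) (s := fun _ => s)
      (fun _ _ => hK) (fun τ hτ => ((hz τ (hsub hτ)).mono hsub).continuousWithinAt)
      (fun τ hτ => (hz τ (hsub (Ico_subset_Icc_self hτ))).mono_of_mem_nhdsWithin
        (Filter.mem_of_superset (Icc_mem_nhdsGE hτ.2)
          ((Icc_subset_Icc_left hτ.1).trans hsub)))
      (fun τ hτ => (hball τ (hsub' (Ico_subset_Icc_self hτ))).2.1 (hsub (Ico_subset_Icc_self hτ)))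
      (fun τ hτ => (hball τ (hsub' hτ)).1.continuousAt.continuousWithinAt)
      (fun τ hτ => (hball τ (hsub' (Ico_subset_Icc_self hτ))).1.hasDerivWithinAt)
      (fun τ hτ => (hball τ (hsub' (Ico_subset_Icc_self hτ))).2.2) hy0.symm ⟨h, le_rfl⟩
  · have hsub : Icc t t₀ ⊆ J := hJ.out htJ ht₀
    have hsub' : Icc t t₀ ⊆ Ioo (t₀ - ε) (t₀ + ε) := fun τ hτ =>
      ⟨ht.1.trans_le hτ.1, by linarith [hτ.2]⟩
    refine ODE_solution_unique_of_mem_Icc_left (v := fun _ => F) (s := fun _ => s)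
      (fun _ _ => hK) (fun τ hτ => ((hz τ (hsub hτ)).mono hsub).continuousWithinAt)
      (fun τ hτ => (hz τ (hsub (Ioc_subset_Icc_self hτ))).mono_of_mem_nhdsWithin
        (Filter.mem_of_superset (Icc_mem_nhdsLE hτ.1)
          ((Icc_subset_Icc_right hτ.2).trans hsub)))
      (fun τ hτ => (hball τ (hsub' (Ioc_subset_Icc_self hτ))).2.1 (hsub (Ioc_subset_Icc_self hτ)))
      (fun τ hτ => (hball τ (hsub' hτ)).1.continuousAt.continuousWithinAt)
      (fun τ hτ => (hball τ (hsub' (Ioc_subset_Icc_self hτ))).1.hasDerivWithinAt)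
      (fun τ hτ => (hball τ (hsub' (Ioc_subset_Icc_self hτ))).2.2) hy0.symm ⟨le_rfl, h⟩

/-- A function on an interval which near each point of the interval agrees with an analytic function
has an analytic extension to a neighbourhood of the interval. -/
theorem exists_analyticOnNhd_extension {z : ℝ → E} (hJ : J.OrdConnected) (hJn : J.Nontrivial)
    (h : ∀ t₀ ∈ J, ∃ y : ℝ → E, AnalyticAt ℝ y t₀ ∧ ∀ᶠ t in nhds t₀, t ∈ J → z t = y t) :
    ∃ y : ℝ → E, AnalyticOnNhd ℝ y J ∧ EqOn z y J := by
  classical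
  choose! Y hYa hY using h
  obtain ⟨j, hj⟩ := hJn.nonempty
  -- Outside `J`, the local extension at the nearer endpoint is used. If that endpoint is missing or
  -- infinite, the values there do not matter: analyticity is required only at points of `J`.
  refine ⟨fun t => if t ∈ J then z t else if t < j then Y (sInf J) t else Y (sSup J) t,
    fun t₀ ht₀ => (hYa t₀ ht₀).congr ?_, fun t ht => by simp [ht]⟩
  by_cases hl : ∃ s ∈ J, s < t₀
  · obtain ⟨s, hs, hst⟩ := hl
    by_cases hr : ∃ r ∈ J, t₀ < r
    · obtain ⟨r, hr, htr⟩ := hr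
      filter_upwards [Icc_mem_nhds hst htr, hY t₀ ht₀] with t ht hYt
      have : t ∈ J := hJ.out hs hr ht
      simp [this, hYt this]
    · push Not at hr
      have hsup : sSup J = t₀ := IsGreatest.csSup_eq ⟨ht₀, hr⟩
      filter_upwards [Ioi_mem_nhds hst, hY t₀ ht₀] with t ht hYt
      by_cases htJ : t ∈ J
      · simp [htJ, hYt htJ]
      · have : ¬ t < j := fun htj => htJ (hJ.out hs hj ⟨le_of_lt ht, htj.le⟩)
        simp [htJ, this, hsup]
  · push Not at hl
    have hinf : sInf J = t₀ := IsLeast.csInf_eq ⟨ht₀, hl⟩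
    obtain ⟨r, hr, hrt⟩ := hJn.exists_ne t₀
    have htr : t₀ < r := lt_of_le_of_ne (hl r hr) hrt.symm
    filter_upwards [Iio_mem_nhds htr, hY t₀ ht₀] with t ht hYt
    by_cases htJ : t ∈ J
    · simp [htJ, hYt htJ]
    · have : t < j := by
        by_contra htj
        exact htJ (hJ.out hj hr ⟨not_lt.1 htj, le_of_lt ht⟩)
      simp [htJ, this, hinf]

/-- The frontier of a convex set is null. At interior points, behaviour on `J` alone determines
two-sided derivatives. -/
theorem Set.OrdConnected.ae_mem_interior (hJ : J.OrdConnected) :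
    ∀ᵐ t ∂volume.restrict J, t ∈ interior J := by
  have hnull := hJ.convex.addHaar_frontier volume
  have : ∀ᵐ t ∂(volume : Measure ℝ), t ∉ frontier J := measure_eq_zero_iff_ae_notMem.1 hnull
  rw [ae_restrict_iff'₀ (nullMeasurableSet_of_null_frontier hnull)]
  filter_upwards [this] with t ht htJ
  by_contra hti
  exact ht ⟨subset_closure htJ, hti⟩

theorem Set.OrdConnected.subset_closure_interior (hJ : J.OrdConnected) (hJn : J.Nontrivial) :
    J ⊆ closure (interior J) := by
  obtain ⟨a, ha, b, hb, hab⟩ := hJn.exists_lt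
  have hne : (interior J).Nonempty := by
    obtain ⟨c, hc⟩ := exists_between hab
    exact ⟨c, interior_mono (hJ.out ha hb) (by rwa [interior_Icc])⟩
  rw [(hJ.convex : Convex ℝ J).closure_interior_eq_closure_of_nonempty_interior hne]
  exact subset_closure

/-- An inequality between continuous functions on an interval extends from almost every point. -/
theorem ContinuousOn.le_of_ae_le {φ χ : ℝ → ℝ} (hJ : J.OrdConnected) (hJn : J.Nontrivial)
    (hφ : ContinuousOn φ J) (hχ : ContinuousOn χ J) (h : ∀ᵐ t ∂volume.restrict J, φ t ≤ χ t) :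
    ∀ t ∈ J, φ t ≤ χ t := by
  -- Writing the inequality as the equation `max φ χ = χ` lets almost-everywhere equality of
  -- continuous functions be used.
  have : EqOn (fun t => max (φ t) (χ t)) χ J := by
    refine Measure.eqOn_of_ae_eq (μ := volume) ?_ (hφ.sup hχ) hχ (hJ.subset_closure_interior hJn)
    filter_upwards [h] with t ht
    exact max_eq_right ht
  exact fun t ht => max_eq_right_iff.1 (this ht)

/-- If a function vanishes on an interval, so does its derivative, almost everywhere. -/
theorem ae_deriv_eq_zero_of_eqOn_zero {φ φ' : ℝ → ℝ} (hJ : J.OrdConnected)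
    (h0 : ∀ t ∈ J, φ t = 0) (hd : ∀ᵐ t ∂volume.restrict J, HasDerivAt φ (φ' t) t) :
    ∀ᵐ t ∂volume.restrict J, φ' t = 0 := by
  filter_upwards [hd, hJ.ae_mem_interior] with t ht hti
  refine ht.unique ((hasDerivAt_const t (0 : ℝ)).congr_of_eventuallyEq ?_)
  filter_upwards [mem_interior_iff_mem_nhds.1 hti] with s hs using h0 s hs

/-- An absolutely continuous function whose derivative agrees almost everywhere with a function that
is continuous on an interval is differentiable on that interval. -/
theorem AbsolutelyContinuousOnInterval.hasDerivWithinAt_of_ae [CompleteSpace E] {z h : ℝ → E}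
    {a b : ℝ} (hz : AbsolutelyContinuousOnInterval z a b) (hab : a ≤ b) (hJ : J.OrdConnected)
    (hJn : J.Nontrivial) (hJT : J ⊆ Icc a b) (hh : ContinuousOn h J)
    (hd : ∀ᵐ t ∂volume.restrict J, HasDerivAt z (h t) t) {t : ℝ} (ht : t ∈ J) :
    HasDerivWithinAt z (h t) J t := by
  have key : ∀ c ∈ J, ∀ d ∈ J, c < d → ∀ s ∈ Icc c d, HasDerivWithinAt z (h s) (Icc c d) s := by
    intro c hc d hd' hcd s hs
    have hsub : Icc c d ⊆ J := hJ.out hc hd'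
    -- Clamping makes `h` continuous on all of `ℝ`, so its primitive `W` is `C¹`. Then `z - W` is
    -- absolutely continuous with derivative zero almost everywhere, hence constant.
    set H : ℝ → E := IccExtend hcd.le ((Icc c d).domRestrict h) with hH
    have hHc : Continuous H := (continuousOn_iff_continuous_domRestrict.1 (hh.mono hsub)).Icc_extend'
    have hHeq : ∀ τ ∈ Icc c d, H τ = h τ := fun τ hτ => IccExtend_of_mem hcd.le _ hτ
    set W : ℝ → E := fun τ => ∫ r in c..τ, H r with hW
    have hWd : ∀ τ, HasDerivAt W (H τ) τ := fun τ => hHc.integral_hasStrictDerivAt c τ |>.hasDerivAt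
    have hWac : AbsolutelyContinuousOnInterval W c d := by
      refine ContDiffOn.absolutelyContinuousOnInterval (ContDiff.contDiffOn ?_)
      rw [contDiff_one_iff_deriv]
      refine ⟨fun τ => (hWd τ).differentiableAt, ?_⟩
      rwa [show deriv W = H from funext fun τ => (hWd τ).deriv]
    have hzac : AbsolutelyContinuousOnInterval z c d := hz.mono (by
      rw [uIcc_of_le hab, uIcc_of_le hcd.le]; exact hsub.trans hJT)
    obtain ⟨C, hC⟩ := (hzac.sub hWac).const_of_ae_hasDerivAt_zero (by
      rw [uIcc_of_le hcd.le]
      have := (ae_restrict_iff' measurableSet_Icc).1 (ae_restrict_of_ae_restrict_of_subset hsub hd)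
      filter_upwards [this] with τ hτ hmem
      have h1 := (hτ hmem).sub (hWd τ)
      rwa [hHeq τ hmem, sub_self] at h1)
    rw [uIcc_of_le hcd.le] at hC
    have hzW : ∀ τ ∈ Icc c d, z τ = W τ + C := fun τ hτ => by
      rw [← hC τ hτ]; simp
    refine HasDerivWithinAt.congr ?_ hzW (hzW s hs)
    rw [← hHeq s hs]
    exact ((hWd s).add_const C).hasDerivWithinAt
  -- It remains to choose a compact subinterval of `J` that is a neighbourhood of `t` within `J`,
  -- one-sided at an endpoint.
  by_cases hl : ∃ s ∈ J, s < t
  · obtain ⟨s, hs, hst⟩ := hl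
    by_cases hr : ∃ r ∈ J, t < r
    · obtain ⟨r, hr, htr⟩ := hr
      exact (key s hs r hr (hst.trans htr) t ⟨hst.le, htr.le⟩).mono_of_mem_nhdsWithin
        (mem_nhdsWithin_of_mem_nhds (Icc_mem_nhds hst htr))
    · push Not at hr
      exact (key s hs t ht hst t ⟨hst.le, le_rfl⟩).mono_of_mem_nhdsWithin
        (nhdsWithin_mono t hr (Icc_mem_nhdsLE hst))
  · push Not at hl
    obtain ⟨r, hr, hrt⟩ := hJn.exists_ne t
    have htr : t < r := lt_of_le_of_ne (hl r hr) hrt.symm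
    exact (key t ht r hr htr t ⟨le_rfl, htr.le⟩).mono_of_mem_nhdsWithin
      (nhdsWithin_mono t hl (Icc_mem_nhdsGE htr))

end IntervalODE

/-! ### Closure properties of analytic maps. -/

section Analytic

variable {E F : Type*} [NormedAddCommGroup E] [NormedSpace ℝ E]
  [NormedAddCommGroup F] [NormedSpace ℝ F] {y : E}

theorem AnalyticAt.comp_fst {X : E → F} (hX : AnalyticAt ℝ X y) {G : Type*} [NormedAddCommGroup G]
    [NormedSpace ℝ G] (p : G) : AnalyticAt ℝ (fun z : E × G => X z.1) (y, p) :=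
  AnalyticAt.comp_of_eq hX analyticAt_fst rfl

theorem AnalyticAt.dotProduct {ι : Type*} [Fintype ι] {a b : E → ι → ℝ} (ha : AnalyticAt ℝ a y)
    (hb : AnalyticAt ℝ b y) : AnalyticAt ℝ (fun z => a z ⬝ᵥ b z) y := by
  simp only [_root_.dotProduct]
  exact Finset.analyticAt_fun_sum _ fun i _ =>
    (analyticAt_pi_iff.1 ha i).mul (analyticAt_pi_iff.1 hb i)

theorem AnalyticAt.det {ι : Type*} [Fintype ι] [DecidableEq ι] {B : E → Matrix ι ι ℝ}
    (hB : ∀ i j, AnalyticAt ℝ (fun z => B z i j) y) : AnalyticAt ℝ (fun z => (B z).det) y := by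
  simp only [Matrix.det_apply']
  exact Finset.analyticAt_fun_sum _ fun σ _ => analyticAt_const.mul
    (Finset.analyticAt_fun_prod _ fun i _ => hB (σ i) i)

theorem AnalyticAt.matrix_inv {ι : Type*} [Fintype ι] [DecidableEq ι] {B : E → Matrix ι ι ℝ}
    (hB : ∀ i j, AnalyticAt ℝ (fun z => B z i j) y) (hdet : (B y).det ≠ 0) (i j : ι) :
    AnalyticAt ℝ (fun z => (B z)⁻¹ i j) y := by
  have h : (fun z => (B z)⁻¹ i j) =
      fun z => (B z).det⁻¹ * ((B z).updateRow j (Pi.single i 1)).det := by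
    funext z
    simp [Matrix.inv_def, Matrix.adjugate_apply, Ring.inverse_eq_inv']
  rw [h]
  refine ((AnalyticAt.det hB).inv hdet).mul (AnalyticAt.det fun r s => ?_)
  by_cases hr : r = j
  · subst hr; simpa using analyticAt_const
  · simpa [Matrix.updateRow_ne hr] using hB r s

theorem AnalyticAt.continuousLinearMap_apply {G : Type*} [NormedAddCommGroup G] [NormedSpace ℝ G]
    [CompleteSpace F] [CompleteSpace G] {A : E → F →L[ℝ] G} {X : E → F} (hA : AnalyticAt ℝ A y)
    (hX : AnalyticAt ℝ X y) : AnalyticAt ℝ (fun z => A z (X z)) y :=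
  (hA.contDiffAt.clm_apply hX.contDiffAt).analyticAt

theorem AnalyticAt.lieBracket [CompleteSpace E] {V W : E → E} (hV : AnalyticAt ℝ V y)
    (hW : AnalyticAt ℝ W y) : AnalyticAt ℝ (VectorField.lieBracket ℝ V W) y := by
  exact (hW.fderiv.continuousLinearMap_apply hV).sub (hV.fderiv.continuousLinearMap_apply hW)

end Analytic

/-! ### The Euclidean pairing of costates and tangent vectors. -/

section Pairing

variable {n : ℕ} (p q w w' : PhaseSpace n)

theorem pairing_add_right : pairing p (w + w') = pairing p w + pairing p w' := by
  simp [pairing, dotProduct_add]; ring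

theorem pairing_sub_right : pairing p (w - w') = pairing p w - pairing p w' := by
  simp [pairing, dotProduct_sub]; ring

theorem pairing_smul_right (c : ℝ) : pairing p (c • w) = c * pairing p w := by
  simp [pairing, mul_add]

theorem pairing_sum_right {ι : Type*} (s : Finset ι) (X : ι → PhaseSpace n) :
    pairing p (∑ i ∈ s, X i) = ∑ i ∈ s, pairing p (X i) := by
  classical
  induction s using Finset.induction_on with
  | empty => simp [pairing]
  | insert a s ha ih => rw [Finset.sum_insert ha, Finset.sum_insert ha, pairing_add_right, ih]

theorem pairing_zero_right : pairing p 0 = 0 := by simp [pairing]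

theorem eq_zero_of_forall_pairing_eq_zero {p : PhaseSpace n} (h : ∀ w, pairing p w = 0) :
    p = 0 := by
  have h' := h p
  rw [pairing] at h'
  have h1 : 0 ≤ p.1 ⬝ᵥ p.1 := Finset.sum_nonneg fun i _ => mul_self_nonneg _
  have h2 : 0 ≤ p.2 ⬝ᵥ p.2 := Finset.sum_nonneg fun i _ => mul_self_nonneg _
  exact Prod.ext (dotProduct_self_eq_zero.1 (by linarith)) (dotProduct_self_eq_zero.1 (by linarith))

theorem AnalyticAt.pairing {E : Type*} [NormedAddCommGroup E] [NormedSpace ℝ E] {y : E}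
    {a b : E → PhaseSpace n} (ha : AnalyticAt ℝ a y) (hb : AnalyticAt ℝ b y) :
    AnalyticAt ℝ (fun z => pairing (a z) (b z)) y :=
  ((analyticAt_fst.fun_comp ha).dotProduct (analyticAt_fst.fun_comp hb)).add
    ((analyticAt_snd.fun_comp ha).dotProduct (analyticAt_snd.fun_comp hb))

theorem HasDerivAt.pairing {a b : ℝ → PhaseSpace n} {a' b' : PhaseSpace n} {t : ℝ}
    (ha : HasDerivAt a a' t) (hb : HasDerivAt b b' t) :
    HasDerivAt (fun s => pairing (a s) (b s)) (pairing a' (b t) + pairing (a t) b') t := by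
  have key {α β : ℝ → Fin n → ℝ} {α' β' : Fin n → ℝ} (hα : HasDerivAt α α' t)
      (hβ : HasDerivAt β β' t) :
      HasDerivAt (fun s => α s ⬝ᵥ β s) (α' ⬝ᵥ β t + α t ⬝ᵥ β') t := by
    simp only [_root_.dotProduct, ← Finset.sum_add_distrib]
    exact HasDerivAt.fun_sum fun i _ => (hasDerivAt_pi.1 hα i).mul (hasDerivAt_pi.1 hβ i)
  have h := (key ha.fst hb.fst).add (key ha.snd hb.snd)
  refine h.congr_deriv ?_
  simp only [_root_.pairing]
  ring

end Pairing

/-! ### Analyticity and brackets of the system fields; derivatives along extremals. -/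

namespace MechanicalSystem

variable {n : ℕ} (S : MechanicalSystem n) {y : PhaseSpace n}

theorem analyticAt_L {q : Fin n → ℝ} (hq : q ∈ S.Q) (i j : Fin n) :
    AnalyticAt ℝ (fun z => S.L z i j) q :=
  AnalyticAt.matrix_inv (fun i j => S.analytic_M i j q hq) (S.posDef_M q hq).det_pos.ne' i j

theorem analyticAt_g (hy : y.1 ∈ S.Q) (i : Fin n) : AnalyticAt ℝ (S.g i) y :=
  analyticAt_const.prod (AnalyticAt.pi fun r => (S.analyticAt_L hy r i).fun_comp analyticAt_fst)

theorem analyticAt_f (hy : y.1 ∈ S.Q) : AnalyticAt ℝ S.f y := by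
  have hC := S.analytic_C y ⟨hy, mem_univ _⟩
  have hG : AnalyticAt ℝ (fun z : PhaseSpace n => S.G z.1) y :=
    (S.analytic_G y.1 hy).fun_comp analyticAt_fst
  refine analyticAt_snd.prod (AnalyticAt.neg (AnalyticAt.pi fun r => ?_))
  exact (AnalyticAt.pi fun s => (S.analyticAt_L hy r s).fun_comp analyticAt_fst).dotProduct
    (hC.add hG)

theorem analyticAt_fg (hy : y.1 ∈ S.Q) (i : Fin n) : AnalyticAt ℝ (S.fg i) y :=
  (S.analyticAt_f hy).lieBracket (S.analyticAt_g hy i)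

theorem analyticAt_ffg (hy : y.1 ∈ S.Q) (i : Fin n) : AnalyticAt ℝ (S.ffg i) y :=
  (S.analyticAt_f hy).lieBracket (S.analyticAt_fg hy i)

theorem analyticAt_gfg (hy : y.1 ∈ S.Q) (i j : Fin n) : AnalyticAt ℝ (S.gfg i j) y :=
  (S.analyticAt_g hy i).lieBracket (S.analyticAt_fg hy j)

theorem analyticAt_alpha (hy : y.1 ∈ S.Q) (i j k : Fin n) : AnalyticAt ℝ (S.alpha i j k) y :=
  (AnalyticAt.pi fun s => (S.analytic_M k s y.1 hy).fun_comp analyticAt_fst).dotProduct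
    (analyticAt_snd.fun_comp (S.analyticAt_gfg hy i j))

theorem fderiv_g_eq_zero (hy : y.1 ∈ S.Q) (i : Fin n) {w : PhaseSpace n} (hw : w.1 = 0) :
    fderiv ℝ (S.g i) y w = 0 := by
  have hL : DifferentiableAt ℝ (fun q => fun r => S.L q r i) y.1 :=
    differentiableAt_pi.2 fun r => S.differentiableAt_L hy r i
  have h : HasFDerivAt (S.g i) _ y := (hasFDerivAt_const (0 : Fin n → ℝ) y).prodMk
    (hL.hasFDerivAt.comp y (hasFDerivAt_fst (𝕜 := ℝ) (p := y)))
  rw [h.fderiv]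
  simp [hw]

/-- Each `g_i` is vertical and depends only on `q`, so it is constant in the direction of every
`g_j`. -/
theorem lieBracket_g_g (hy : y.1 ∈ S.Q) (i j : Fin n) :
    VectorField.lieBracket ℝ (S.g i) (S.g j) y = 0 := by
  rw [VectorField.lieBracket, S.fderiv_g_eq_zero hy j rfl, S.fderiv_g_eq_zero hy i rfl, sub_zero]

theorem eventually_mem_Q (hy : y.1 ∈ S.Q) : ∀ᶠ z : PhaseSpace n in nhds y, z.1 ∈ S.Q :=
  (S.isOpen_Q.preimage continuous_fst).mem_nhds hy

/-- Jacobi identity for `g_i, f, g_j`, with the term `[f, [g_i, g_j]]` equal to zero. The symmetry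
matters because differentiating `⟨p, fg_i⟩` produces `g_j fg_i`, whereas `A_k` and `b_kk` are
written with `α_{ijk}`. -/
theorem gfg_comm (hy : y.1 ∈ S.Q) (i j : Fin n) : S.gfg i j y = S.gfg j i y := by
  have hJacobi := VectorField.leibniz_identity_lieBracket (𝕜 := ℝ) (n := 2) (by simp)
    (S.analyticAt_g hy i).contDiffAt (S.analyticAt_f hy).contDiffAt
    (S.analyticAt_g hy j).contDiffAt
  have hzero : VectorField.lieBracket ℝ (S.g i) (S.g j) =ᶠ[nhds y] 0 := by
    filter_upwards [S.eventually_mem_Q hy] with z hz using S.lieBracket_g_g hz i j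
  rw [Filter.EventuallyEq.rfl.lieBracket_vectorField_eq hzero, VectorField.lieBracket_zero_right,
    Pi.zero_apply, add_zero, show VectorField.lieBracket ℝ (S.g i) S.f = -S.fg i from
      funext fun z => VectorField.lieBracket_swap] at hJacobi
  refine hJacobi.trans ?_
  rw [gfg, VectorField.lieBracket_swap, VectorField.lieBracket, VectorField.lieBracket, fderiv_neg]
  simp [neg_add_eq_sub]

theorem alpha_comm (hy : y.1 ∈ S.Q) (i j k : Fin n) : S.alpha i j k y = S.alpha j i k y := by
  rw [alpha, alpha, S.gfg_comm hy]

theorem hasFDerivAt_rhs (hy : y.1 ∈ S.Q) (a : Fin n → ℝ) :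
    HasFDerivAt (S.rhs a) (fderiv ℝ S.f y + ∑ i, a i • fderiv ℝ (S.g i) y) y :=
  (S.differentiableAt_f hy).hasFDerivAt.add
    (HasFDerivAt.fun_sum fun i _ => (S.differentiableAt_g hy i).hasFDerivAt.const_smul (a i))

/-- With `a` frozen, the left side is the pairing with the bracket of `S.rhs a` and `X`, which is
linear in the first field. -/
theorem pairing_lieBracket_rhs (hy : y.1 ∈ S.Q) (a : Fin n → ℝ) (X : PhaseSpace n → PhaseSpace n)
    (p : PhaseSpace n) :
    pairing p (fderiv ℝ X y (S.rhs a y) - fderiv ℝ (S.rhs a) y (X y)) =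
      pairing p (VectorField.lieBracket ℝ S.f X y) +
        ∑ j, a j * pairing p (VectorField.lieBracket ℝ (S.g j) X y) := by
  rw [(S.hasFDerivAt_rhs hy a).fderiv]
  simp only [← pairing_smul_right, ← pairing_sum_right, ← pairing_add_right]
  congr 1
  simp only [VectorField.lieBracket, rhs, map_add, map_sum, map_smul, _root_.add_apply,
    _root_.sum_apply, _root_.smul_apply, smul_sub, Finset.sum_sub_distrib]
  abel

/-- The derivative of `⟨p, X(x)⟩` along a solution of the state and adjoint equations. -/
theorem hasDerivAt_pairing {x p : ℝ → PhaseSpace n} {t : ℝ} {a : Fin n → ℝ} {p' : PhaseSpace n}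
    (hxt : (x t).1 ∈ S.Q) (hx : HasDerivAt x (S.rhs a (x t)) t) (hp : HasDerivAt p p' t)
    (hp' : ∀ w, pairing p' w = -pairing (p t) (fderiv ℝ (S.rhs a) (x t) w))
    {X : PhaseSpace n → PhaseSpace n} (hX : DifferentiableAt ℝ X (x t)) :
    HasDerivAt (fun s => pairing (p s) (X (x s)))
      (pairing (p t) (VectorField.lieBracket ℝ S.f X (x t)) +
        ∑ j, a j * pairing (p t) (VectorField.lieBracket ℝ (S.g j) X (x t))) t := by
  refine (hp.pairing (hX.hasFDerivAt.comp_hasDerivAt t hx)).congr_deriv ?_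
  rw [← S.pairing_lieBracket_rhs hxt, hp', pairing_sub_right, Function.comp_apply]
  ring

end MechanicalSystem

/-! ### The feedback law, the closed loop and the maximum condition. -/

theorem add_smul_vecMul_eq_zero_iff {ι : Type*} [Fintype ι] [DecidableEq ι] {B : Matrix ι ι ℝ}
    (hB : B.det ≠ 0) {s : ℝ} (hs : s ≠ 0) (d w : ι → ℝ) :
    d + s • (w ᵥ* B) = 0 ↔ w = -((s⁻¹ • d) ᵥ* B⁻¹) := by
  constructor
  · intro h
    have h1 : w ᵥ* B = -(s⁻¹ • d) := by
      rw [eq_neg_of_add_eq_zero_left h, smul_neg, smul_smul, inv_mul_cancel₀ hs, one_smul, neg_neg]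
    rw [← neg_vecMul, ← h1, vecMul_vecMul, Matrix.mul_nonsing_inv _ hB.isUnit, vecMul_one]
  · rintro rfl
    rw [neg_vecMul, vecMul_vecMul, Matrix.nonsing_inv_mul _ hB.isUnit, vecMul_one, smul_neg,
      smul_smul, mul_inv_cancel₀ hs, one_smul, add_neg_cancel]

namespace MechanicalSystem

variable {n : ℕ} (S : MechanicalSystem n) {y : PhaseSpace n}

/-- The control, as a function of state and costate, along an extremal with `u_k = c` that is
singular for the other controls. -/
noncomputable def feedback (k : Fin n) (c : ℝ) (z : PhaseSpace n × PhaseSpace n) : Fin n → ℝ :=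
  fun j => if h : j = k then c else
    (-(((S.switching k z.1 z.2)⁻¹ • (S.psi k z.1 z.2 + (c * S.switching k z.1 z.2) • S.b k z.1)) ᵥ*
      (S.A k z.1)⁻¹)) ⟨j, h⟩

/-- The right-hand side `-(∂(f + g a)/∂x)ᵀ p` of the adjoint equation. -/
noncomputable def adjointField (a : Fin n → ℝ) (y p : PhaseSpace n) : PhaseSpace n :=
  (fun i => -pairing p (fderiv ℝ S.f y (Pi.single i 1, 0) +
      ∑ j, a j • fderiv ℝ (S.g j) y (Pi.single i 1, 0)),
    fun i => -pairing p (fderiv ℝ S.f y (0, Pi.single i 1) +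
      ∑ j, a j • fderiv ℝ (S.g j) y (0, Pi.single i 1)))

theorem eq_adjointField (hy : y.1 ∈ S.Q) {a : Fin n → ℝ} {p p' : PhaseSpace n}
    (h : ∀ w, pairing p' w = -pairing p (fderiv ℝ (S.rhs a) y w)) : p' = S.adjointField a y p := by
  rw [(S.hasFDerivAt_rhs hy a).fderiv] at h
  refine Prod.ext (funext fun i => ?_) (funext fun i => ?_)
  · simpa [pairing, adjointField] using h (Pi.single i 1, 0)
  · simpa [pairing, adjointField] using h (0, Pi.single i 1)

theorem analyticAt_switching (hy : y.1 ∈ S.Q) (k : Fin n) (p : PhaseSpace n) :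
    AnalyticAt ℝ (fun z : PhaseSpace n × PhaseSpace n => S.switching k z.1 z.2) (y, p) :=
  analyticAt_snd.pairing ((S.analyticAt_g hy k).comp_fst p)

theorem analyticAt_feedback {k : Fin n} (c : ℝ) (hy : y ∈ S.region k) {p : PhaseSpace n}
    (hp : S.switching k y p ≠ 0) (j : Fin n) :
    AnalyticAt ℝ (fun z => S.feedback k c z j) (y, p) := by
  have hQ : y.1 ∈ S.Q := hy.1.1
  by_cases h : j = k
  · simpa [feedback, h] using analyticAt_const
  have hsw := S.analyticAt_switching hQ k p
  simp only [feedback, h, dite_false]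
  refine AnalyticAt.neg (AnalyticAt.dotProduct (AnalyticAt.pi fun i => ?_)
    (AnalyticAt.pi fun i => AnalyticAt.matrix_inv (B := fun z : PhaseSpace n × PhaseSpace n => S.A k z.1)
      (y := (y, p)) (fun r s => ?_) hy.2 _ _))
  · refine (hsw.inv hp).mul (AnalyticAt.add ?_ ((analyticAt_const.mul hsw).mul ?_))
    · exact analyticAt_snd.pairing ((S.analyticAt_ffg hQ i).comp_fst p)
    · exact (S.analyticAt_alpha hQ i k k).comp_fst p
  · exact (S.analyticAt_alpha hQ s r k).comp_fst p

/-- The closed loop vector field for state and costate. -/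
noncomputable def closedLoop (k : Fin n) (c : ℝ) (z : PhaseSpace n × PhaseSpace n) :
    PhaseSpace n × PhaseSpace n :=
  (S.rhs (S.feedback k c z) z.1, S.adjointField (S.feedback k c z) z.1 z.2)

theorem analyticAt_closedLoop {k : Fin n} (c : ℝ) (hy : y ∈ S.region k) {p : PhaseSpace n}
    (hp : S.switching k y p ≠ 0) : AnalyticAt ℝ (S.closedLoop k c) (y, p) := by
  have hQ : y.1 ∈ S.Q := hy.1.1
  have hU := S.analyticAt_feedback c hy hp
  have hf := (S.analyticAt_f hQ).comp_fst p
  have hg (j) := (S.analyticAt_g hQ j).comp_fst p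
  have hf' := (S.analyticAt_f hQ).fderiv.comp_fst p
  have hg' (j) := (S.analyticAt_g hQ j).fderiv.comp_fst p
  have key (w : PhaseSpace n) : AnalyticAt ℝ (fun z : PhaseSpace n × PhaseSpace n =>
      -pairing z.2 (fderiv ℝ S.f z.1 w + ∑ j, S.feedback k c z j • fderiv ℝ (S.g j) z.1 w)) (y, p) :=
    (analyticAt_snd.pairing ((hf'.continuousLinearMap_apply analyticAt_const).add
      (Finset.analyticAt_fun_sum _ fun j _ =>
        (hU j).smul ((hg' j).continuousLinearMap_apply analyticAt_const)))).neg
  refine AnalyticAt.prod (hf.add (Finset.analyticAt_fun_sum _ fun j _ => (hU j).smul (hg j))) ?_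
  exact (AnalyticAt.pi fun i => key _).prod (AnalyticAt.pi fun i => key _)

theorem hamiltonian_eq (y : PhaseSpace n) (a : Fin n → ℝ) (p : PhaseSpace n) :
    S.hamiltonian y a p = pairing p (S.f y) + ∑ i, a i * S.switching i y p - 1 := by
  simp only [hamiltonian, rhs, pairing_add_right, pairing_sum_right, pairing_smul_right, switching]

/-- The Hamiltonian is affine in the control with slope `φ_k` in direction `k`; a nonzero `φ_k`
therefore forces a maximizer to a bound in that coordinate. -/
theorem hamiltonian_update_sub (y : PhaseSpace n) (a : Fin n → ℝ) (p : PhaseSpace n) (k : Fin n)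
    (c : ℝ) : S.hamiltonian y (Function.update a k c) p - S.hamiltonian y a p =
      (c - a k) * S.switching k y p := by
  have h (b : Fin n → ℝ) : ∑ i, b i * S.switching i y p =
      b k * S.switching k y p + ∑ i ∈ Finset.univ.erase k, b i * S.switching i y p :=
    (Finset.add_sum_erase _ _ (Finset.mem_univ k)).symm
  have h' : ∑ i ∈ Finset.univ.erase k, Function.update a k c i * S.switching i y p =
      ∑ i ∈ Finset.univ.erase k, a i * S.switching i y p :=
    Finset.sum_congr rfl fun i hi => by rw [Function.update_of_ne (Finset.ne_of_mem_erase hi)]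
  rw [S.hamiltonian_eq, S.hamiltonian_eq, h, h a, h', Function.update_self]
  ring

theorem eq_hi_of_isMaxOn {lo hi a : Fin n → ℝ} {p : PhaseSpace n} {k : Fin n} (ha : a ∈ Icc lo hi)
    (hmax : IsMaxOn (fun a => S.hamiltonian y a p) (Icc lo hi) a)
    (hpos : 0 < S.switching k y p) : a k = hi k := by
  have hmem : Function.update a k (hi k) ∈ Icc lo hi :=
    ⟨le_update_iff.2 ⟨(ha.1 k).trans (ha.2 k), fun i _ => ha.1 i⟩,
      update_le_iff.2 ⟨le_rfl, fun i _ => ha.2 i⟩⟩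
  have h1 := S.hamiltonian_update_sub y a p k (hi k)
  have h2 : S.hamiltonian y (Function.update a k (hi k)) p ≤ S.hamiltonian y a p := hmax hmem
  have h3 : hi k - a k ≤ 0 := nonpos_of_mul_nonpos_left (by linarith) hpos
  exact le_antisymm (ha.2 k) (by linarith)

theorem eq_lo_of_isMaxOn {lo hi a : Fin n → ℝ} {p : PhaseSpace n} {k : Fin n} (ha : a ∈ Icc lo hi)
    (hmax : IsMaxOn (fun a => S.hamiltonian y a p) (Icc lo hi) a)
    (hneg : S.switching k y p < 0) : a k = lo k := by
  have hmem : Function.update a k (lo k) ∈ Icc lo hi :=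
    ⟨le_update_iff.2 ⟨le_rfl, fun i _ => ha.1 i⟩,
      update_le_iff.2 ⟨(ha.1 k).trans (ha.2 k), fun i _ => ha.2 i⟩⟩
  have h1 := S.hamiltonian_update_sub y a p k (lo k)
  have h2 : S.hamiltonian y (Function.update a k (lo k)) p ≤ S.hamiltonian y a p := hmax hmem
  have h3 : a k - lo k ≤ 0 := nonpos_of_mul_nonneg_left (by linarith) hneg
  exact le_antisymm (by linarith) (ha.1 k)

theorem eq_zero_of_mem_spanRegion {k : Fin n} (hy : y ∈ S.spanRegion k) {p : PhaseSpace n}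
    (hg : ∀ i, pairing p (S.g i y) = 0) (hfg : ∀ i, i ≠ k → pairing p (S.fg i y) = 0)
    (hffg : ∀ i, i ≠ k → pairing p (S.ffg i y) = 0) : p = 0 := by
  refine eq_zero_of_forall_pairing_eq_zero fun w => ?_
  have hw : w ∈ (⊤ : Submodule ℝ (PhaseSpace n)) := Submodule.mem_top
  rw [← hy.2] at hw
  induction hw using Submodule.span_induction with
  | mem w h =>
    rcases h with (⟨i, rfl⟩ | ⟨i, hi, rfl⟩) | ⟨i, hi, rfl⟩
    exacts [hg i, hfg i hi, hffg i hi]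
  | zero => exact pairing_zero_right p
  | add a b _ _ ha hb => rw [pairing_add_right, ha, hb, add_zero]
  | smul c a _ ha => rw [pairing_smul_right, ha, mul_zero]

/-- Singularity of the other controls kills every term of the expansion in the `g_l` except the
`k`-th. -/
theorem pairing_gfg (hy : y.1 ∈ S.Q) {k : Fin n} {p : PhaseSpace n}
    (h0 : ∀ i, i ≠ k → S.switching i y p = 0) (i j : Fin n) :
    pairing p (S.gfg i j y) = S.alpha i j k y * S.switching k y p := by
  rw [S.gfg_eq_sum_alpha hy, pairing_sum_right]
  simp only [pairing_smul_right]
  exact Finset.sum_eq_single k (fun i _ hi => by rw [show pairing p (S.g i y) = 0 from h0 i hi,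
    mul_zero]) (by simp)

/-- Along an extremal, `u` is admissible and maximizing and state and costate solve their
equations, at almost every time. -/
theorem IsExtremal.ae_of_subset {S : MechanicalSystem n} {lo hi : Fin n → ℝ} {T : ℝ}
    {x : ℝ → PhaseSpace n} {u : ℝ → Fin n → ℝ} {p : ℝ → PhaseSpace n}
    (hext : S.IsExtremal lo hi T x u p) {J : Set ℝ} (hJT : J ⊆ Icc 0 T) :
    ∀ᵐ t ∂volume.restrict J, u t ∈ Icc lo hi ∧
      IsMaxOn (fun a => S.hamiltonian (x t) a (p t)) (Icc lo hi) (u t) ∧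
      HasDerivAt x (S.rhs (u t) (x t)) t ∧
      ∃ p' : PhaseSpace n, HasDerivAt p p' t ∧
        ∀ w, pairing p' w = -pairing (p t) (fderiv ℝ (S.rhs (u t)) (x t) w) :=
  ae_restrict_of_ae_restrict_of_subset hJT
    (hext.u_mem.and (hext.max_hamiltonian.and (hext.x_deriv.and hext.p_deriv)))

theorem _root_.ContinuousOn.pairing_comp {x p : ℝ → PhaseSpace n} {J : Set ℝ}
    {X : PhaseSpace n → PhaseSpace n} (hx : ContinuousOn x J) (hp : ContinuousOn p J)
    (hX : ∀ t ∈ J, ContinuousAt X (x t)) : ContinuousOn (fun t => pairing (p t) (X (x t))) J := by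
  have hXx : ContinuousOn (fun t => X (x t)) J := fun t ht =>
    (hX t ht).comp_continuousWithinAt (hx t ht)
  have key {α β : ℝ → Fin n → ℝ} (hα : ContinuousOn α J) (hβ : ContinuousOn β J) :
      ContinuousOn (fun s => α s ⬝ᵥ β s) J := by
    simp only [dotProduct]
    exact continuousOn_finsetSum _ fun i _ =>
      (continuousOn_pi.1 hα i).mul (continuousOn_pi.1 hβ i)
  exact (key hp.fst hXx.fst).add (key hp.snd hXx.snd)

/-! ### Consequences of singularity along an extremal. -/

section Singular

variable {S} {lo hi : Fin n → ℝ} {T : ℝ} {x : ℝ → PhaseSpace n} {u : ℝ → Fin n → ℝ}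
  {p : ℝ → PhaseSpace n} {J : Set ℝ}

theorem IsExtremal.continuousOn_x (hext : S.IsExtremal lo hi T x u p) (hJT : J ⊆ Icc 0 T) :
    ContinuousOn x J :=
  (uIcc_of_le hext.T_pos.le ▸ hext.x_ac.continuousOn).mono hJT

theorem IsExtremal.continuousOn_p (hext : S.IsExtremal lo hi T x u p) (hJT : J ⊆ Icc 0 T) :
    ContinuousOn p J :=
  (uIcc_of_le hext.T_pos.le ▸ hext.p_ac.continuousOn).mono hJT

theorem IsExtremal.continuousOn_pairing (hext : S.IsExtremal lo hi T x u p) (hJT : J ⊆ Icc 0 T)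
    {X : PhaseSpace n → PhaseSpace n} (hX : ∀ y : PhaseSpace n, y.1 ∈ S.Q → AnalyticAt ℝ X y) :
    ContinuousOn (fun t => pairing (p t) (X (x t))) J :=
  (hext.continuousOn_x hJT).pairing_comp (hext.continuousOn_p hJT)
    fun t ht => (hX _ (hext.x_mem t (hJT ht))).continuousAt

/-- If `⟨p, X(x)⟩` vanishes on an interval, then so does its derivative along the extremal. -/
theorem IsExtremal.ae_deriv_pairing_eq_zero (hext : S.IsExtremal lo hi T x u p)
    (hJT : J ⊆ Icc 0 T) (hJ : J.OrdConnected)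
    {X : PhaseSpace n → PhaseSpace n} (hX : ∀ y : PhaseSpace n, y.1 ∈ S.Q → AnalyticAt ℝ X y)
    (h0 : ∀ t ∈ J, pairing (p t) (X (x t)) = 0) :
    ∀ᵐ t ∂volume.restrict J, pairing (p t) (VectorField.lieBracket ℝ S.f X (x t)) +
      ∑ j, u t j * pairing (p t) (VectorField.lieBracket ℝ (S.g j) X (x t)) = 0 := by
  refine ae_deriv_eq_zero_of_eqOn_zero hJ h0 ?_
  have hmem : ∀ᵐ t ∂volume.restrict J, t ∈ J := hJ.ae_mem_interior.mono interior_subset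
  filter_upwards [hext.ae_of_subset hJT, hmem] with t ⟨_, _, hx, p', hp, hp'⟩ ht
  have hQ := hext.x_mem t (hJT ht)
  exact S.hasDerivAt_pairing hQ hx hp hp' (hX _ hQ).differentiableAt

/-- The control fields commute, so the derivative of `φ_i` is `⟨p, fg_i⟩`, free of `u`. It vanishes
almost everywhere and is continuous, hence vanishes at every time. -/
theorem IsExtremal.pairing_fg_eq_zero (hext : S.IsExtremal lo hi T x u p)
    (hJT : J ⊆ Icc 0 T) (hJ : J.OrdConnected) (hJn : J.Nontrivial) {i : Fin n}
    (h0 : ∀ t ∈ J, S.switching i (x t) (p t) = 0) :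
    ∀ t ∈ J, pairing (p t) (S.fg i (x t)) = 0 := by
  have hae := hext.ae_deriv_pairing_eq_zero hJT hJ (fun y hy => S.analyticAt_g hy i) h0
  have hmem : ∀ᵐ t ∂volume.restrict J, t ∈ J := hJ.ae_mem_interior.mono interior_subset
  refine Measure.eqOn_of_ae_eq (μ := volume) (g := fun _ => 0) ?_
    (hext.continuousOn_pairing hJT fun y hy => S.analyticAt_fg hy i) continuousOn_const
    (hJ.subset_closure_interior hJn)
  filter_upwards [hae, hmem] with t ht htJ
  simpa [S.lieBracket_g_g (hext.x_mem t (hJT htJ)), pairing_zero_right, fg] using ht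

/-- This is the second derivative of `φ_i = 0`, where the controls first appear. -/
theorem IsExtremal.ae_pairing_ffg (hext : S.IsExtremal lo hi T x u p)
    (hJT : J ⊆ Icc 0 T) (hJ : J.OrdConnected) (hJn : J.Nontrivial) {k : Fin n}
    (h0 : ∀ i, i ≠ k → ∀ t ∈ J, S.switching i (x t) (p t) = 0) {i : Fin n} (hi : i ≠ k) :
    ∀ᵐ t ∂volume.restrict J, pairing (p t) (S.ffg i (x t)) +
      ∑ j, u t j * (S.alpha i j k (x t) * S.switching k (x t) (p t)) = 0 := by
  have hae := hext.ae_deriv_pairing_eq_zero hJT hJ (fun y hy => S.analyticAt_fg hy i)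
    (hext.pairing_fg_eq_zero hJT hJ hJn (h0 i hi))
  have hmem : ∀ᵐ t ∂volume.restrict J, t ∈ J := hJ.ae_mem_interior.mono interior_subset
  filter_upwards [hae, hmem] with t ht htJ
  have hQ := hext.x_mem t (hJT htJ)
  rw [← ht]
  refine congrArg₂ _ rfl (Finset.sum_congr rfl fun j _ => ?_)
  rw [S.alpha_comm hQ, ← S.pairing_gfg hQ (fun i hi => h0 i hi t htJ)]
  rfl

theorem IsExtremal.switching_ne_zero (hext : S.IsExtremal lo hi T x u p)
    (hJT : J ⊆ Icc 0 T) (hJ : J.OrdConnected) (hJn : J.Nontrivial) {k : Fin n}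
    (h0 : ∀ i, i ≠ k → ∀ t ∈ J, S.switching i (x t) (p t) = 0)
    (hR : ∀ t ∈ J, x t ∈ S.spanRegion k) : ∀ t ∈ J, S.switching k (x t) (p t) ≠ 0 := by
  intro t ht hzero
  refine hext.p_ne_zero t (hJT ht) (S.eq_zero_of_mem_spanRegion (hR t ht) (fun i => ?_)
    (fun i hi => hext.pairing_fg_eq_zero hJT hJ hJn (h0 i hi) t ht) fun i hi' => ?_)
  · by_cases hi : i = k
    · exact hi ▸ hzero
    · exact h0 i hi t ht
  -- The equation with `u` holds only almost everywhere and may fail at the given time. Replacing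
  -- `|u_j|` by its bound gives an inequality between continuous functions, valid at every time;
  -- where `φ_k = 0` its right side is zero.
  · have hbound : ∀ t ∈ J, |pairing (p t) (S.ffg i (x t))| ≤
        ∑ j, max |lo j| |hi j| * |S.alpha i j k (x t) * S.switching k (x t) (p t)| := by
      refine ContinuousOn.le_of_ae_le hJ hJn
        (hext.continuousOn_pairing hJT fun y hy => S.analyticAt_ffg hy i).abs ?_ ?_
      · refine continuousOn_finsetSum _ fun j _ => continuousOn_const.mul (ContinuousOn.abs ?_)
        refine ContinuousOn.mul (fun t ht => ?_)
          (hext.continuousOn_pairing hJT fun y hy => S.analyticAt_g hy k)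
        exact (S.analyticAt_alpha (hext.x_mem t (hJT ht)) i j k).continuousAt.comp_continuousWithinAt
          (hext.continuousOn_x hJT t ht)
      · filter_upwards [hext.ae_pairing_ffg hJT hJ hJn h0 hi', hext.ae_of_subset hJT]
          with t ht ⟨hu, _⟩
        rw [eq_neg_of_add_eq_zero_left ht, abs_neg]
        refine (Finset.abs_sum_le_sum_abs _ _).trans (Finset.sum_le_sum fun j _ => ?_)
        rw [abs_mul]
        exact mul_le_mul_of_nonneg_right (abs_le_max_abs_abs (hu.1 j) (hu.2 j)) (abs_nonneg _)
    simpa [hzero] using hbound t ht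

theorem IsExtremal.exists_ae_eq_const (hext : S.IsExtremal lo hi T x u p)
    (hJT : J ⊆ Icc 0 T) (hJ : J.OrdConnected) {k : Fin n}
    (h0 : ∀ t ∈ J, S.switching k (x t) (p t) ≠ 0) :
    ∃ c, (c = lo k ∨ c = hi k) ∧ ∀ᵐ t ∂volume.restrict J, u t k = c := by
  have hcont : ContinuousOn (fun t => S.switching k (x t) (p t)) J :=
    hext.continuousOn_pairing hJT fun y hy => S.analyticAt_g hy k
  have hmem : ∀ᵐ t ∂volume.restrict J, t ∈ J := hJ.ae_mem_interior.mono interior_subset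
  by_cases hpos : ∃ s ∈ J, 0 < S.switching k (x s) (p s)
  · obtain ⟨s, hs, hs0⟩ := hpos
    refine ⟨hi k, Or.inr rfl, ?_⟩
    filter_upwards [hext.ae_of_subset hJT, hmem] with t ⟨hu, hmax, _⟩ ht
    refine S.eq_hi_of_isMaxOn hu hmax ?_
    by_contra hneg
    -- A nonvanishing continuous `φ_k` cannot change sign on an interval.
    obtain ⟨r, hr, hr0⟩ := hJ.isPreconnected.intermediate_value ht hs hcont
      ⟨not_lt.1 hneg, hs0.le⟩
    exact h0 r hr hr0
  · push Not at hpos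
    refine ⟨lo k, Or.inl rfl, ?_⟩
    filter_upwards [hext.ae_of_subset hJT, hmem] with t ⟨hu, hmax, _⟩ ht
    exact S.eq_lo_of_isMaxOn hu hmax (lt_of_le_of_ne (hpos t ht) (h0 t ht))

theorem linearEquation_iff {k : Fin n} {y q : PhaseSpace n} (hA : (S.A k y).det ≠ 0)
    (hq : S.switching k y q ≠ 0) (c : ℝ) (w : {i : Fin n // i ≠ k} → ℝ) :
    S.psi k y q + (c * S.switching k y q) • S.b k y + S.switching k y q • (w ᵥ* S.A k y) = 0 ↔
      w = fun i : {i : Fin n // i ≠ k} => S.feedback k c (y, q) i.1 := by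
  rw [add_smul_vecMul_eq_zero_iff hA hq]
  have : (fun i : {i : Fin n // i ≠ k} => S.feedback k c (y, q) i.1) =
      -(((S.switching k y q)⁻¹ • (S.psi k y q + (c * S.switching k y q) • S.b k y)) ᵥ*
        (S.A k y)⁻¹) := by
    funext i
    simp [feedback, i.2]
  rw [this]

theorem IsExtremal.ae_eq_feedback (hext : S.IsExtremal lo hi T x u p)
    (hJT : J ⊆ Icc 0 T) (hJ : J.OrdConnected) (hJn : J.Nontrivial) {k : Fin n}
    (h0 : ∀ i, i ≠ k → ∀ t ∈ J, S.switching i (x t) (p t) = 0)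
    (hR : ∀ t ∈ J, x t ∈ S.region k) {c : ℝ} (hc : ∀ᵐ t ∂volume.restrict J, u t k = c) :
    ∀ᵐ t ∂volume.restrict J, u t = S.feedback k c (x t, p t) := by
  have hmem : ∀ᵐ t ∂volume.restrict J, t ∈ J := hJ.ae_mem_interior.mono interior_subset
  have hae : ∀ᵐ t ∂volume.restrict J, ∀ i : {i : Fin n // i ≠ k},
      pairing (p t) (S.ffg i (x t)) +
        ∑ j, u t j * (S.alpha i j k (x t) * S.switching k (x t) (p t)) = 0 :=
    ae_all_iff.2 fun i => hext.ae_pairing_ffg hJT hJ hJn h0 i.2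
  filter_upwards [hae, hc, hmem] with t ht hct htJ
  have hQ := hext.x_mem t (hJT htJ)
  have hφ := hext.switching_ne_zero hJT hJ hJn h0 (fun t ht => (hR t ht).1) t htJ
  have hlin := (linearEquation_iff (hR t htJ).2 hφ c (fun i => u t i.1)).1 (by
    funext i
    have hi := ht i
    rw [Fintype.sum_eq_add_sum_subtype_ne _ k, hct] at hi
    simp only [Pi.add_apply, Pi.smul_apply, smul_eq_mul, psi, b, vecMul, dotProduct, A,
      Matrix.of_apply, Pi.zero_apply, Finset.mul_sum]
    rw [← hi, add_assoc]
    congr 2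
    · ring
    · refine Finset.sum_congr rfl fun j _ => ?_
      rw [S.alpha_comm hQ]
      ring)
  funext j
  by_cases hj : j = k
  · subst hj; simp [feedback, hct]
  · exact congrFun hlin ⟨j, hj⟩

end Singular

end MechanicalSystem

/-! ### From the almost-everywhere feedback to analytic controls. -/

theorem mainTheorem1 {n : ℕ} (S : MechanicalSystem n) (lo hi : Fin n → ℝ) (T : ℝ)
    (x : ℝ → PhaseSpace n) (u : ℝ → Fin n → ℝ) (p : ℝ → PhaseSpace n)
    (hext : S.IsExtremal lo hi T x u p) (k : Fin n)
    (J : Set ℝ) (hJT : J ⊆ Set.Icc 0 T) (hJ : J.OrdConnected) (hJ_nontrivial : J.Nontrivial)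
    (hsing : ∀ i, i ≠ k → ∀ t ∈ J, S.switching i (x t) (p t) = 0)
    (hR : ∀ t ∈ J, x t ∈ S.region k) :
    ∃ (v : ℝ → Fin n → ℝ) (c : ℝ),
      (∀ᵐ t ∂MeasureTheory.volume.restrict J, u t = v t) ∧
      (∀ i, AnalyticOnNhd ℝ (fun t => v t i) J) ∧
      (c = lo k ∨ c = hi k) ∧
      (∀ t ∈ J, v t k = c) ∧
      ∀ t ∈ J, ∀ w : {i : Fin n // i ≠ k} → ℝ,
        S.psi k (x t) (p t) + (c * S.switching k (x t) (p t)) • S.b k (x t) +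
            S.switching k (x t) (p t) • (w ᵥ* S.A k (x t)) = 0 ↔
          w = fun i : {i : Fin n // i ≠ k} => v t i.1 := by
  have hφ := hext.switching_ne_zero hJT hJ hJ_nontrivial hsing fun t ht => (hR t ht).1
  obtain ⟨c, hc, huk⟩ := hext.exists_ae_eq_const hJT hJ hφ
  have hu := hext.ae_eq_feedback hJT hJ hJ_nontrivial hsing hR huk
  have hmem : ∀ᵐ t ∂volume.restrict J, t ∈ J := hJ.ae_mem_interior.mono interior_subset
  have hF : ∀ t ∈ J, AnalyticAt ℝ (S.closedLoop k c) (x t, p t) := fun t ht =>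
    S.analyticAt_closedLoop c (hR t ht) (hφ t ht)
  have hFc : ContinuousOn (fun t => S.closedLoop k c (x t, p t)) J := fun t ht =>
    ContinuousAt.comp_continuousWithinAt (f := fun t => (x t, p t)) (hF t ht).continuousAt
      ((hext.continuousOn_x hJT t ht).prodMk (hext.continuousOn_p hJT t ht))
  -- Regularity gain: the closed loop is continuous along `(x, p)`, so the almost-everywhere
  -- equations hold at every point of `J`.
  have hz : ∀ t ∈ J, HasDerivWithinAt (fun t => (x t, p t)) (S.closedLoop k c (x t, p t)) J t := by
    intro t ht
    refine HasDerivWithinAt.prodMk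
      (hext.x_ac.hasDerivWithinAt_of_ae hext.T_pos.le hJ hJ_nontrivial hJT hFc.fst ?_ ht)
      (hext.p_ac.hasDerivWithinAt_of_ae hext.T_pos.le hJ hJ_nontrivial hJT hFc.snd ?_ ht)
    · filter_upwards [hext.ae_of_subset hJT, hu] with t ⟨_, _, hx, _⟩ hut
      rwa [hut] at hx
    · filter_upwards [hext.ae_of_subset hJT, hu, hmem] with t ⟨_, _, _, p', hp, hp'⟩ hut htJ
      rwa [S.eq_adjointField (hext.x_mem t (hJT htJ)) hp', hut] at hp
  obtain ⟨z, hza, hzeq⟩ := exists_analyticOnNhd_extension hJ hJ_nontrivial fun t ht =>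
    exists_analyticAt_eventually_eq hJ hz ht (hF t ht)
  have hzeq' : ∀ t ∈ J, z t = (x t, p t) := fun t ht => (hzeq ht).symm
  -- The modified control is the feedback along the extension `z` of `(x, p)`, so it is analytic
  -- across any endpoint belonging to `J`.
  refine ⟨fun t => S.feedback k c (z t), c, ?_, fun i t ht => ?_, hc,
    fun t _ => by simp [MechanicalSystem.feedback], fun t ht w => ?_⟩
  · filter_upwards [hu, hmem] with t hut htJ
    rw [hut, hzeq' t htJ]
  · exact AnalyticAt.fun_comp (g := fun z => S.feedback k c z i)
      (by rw [hzeq' t ht]; exact S.analyticAt_feedback c (hR t ht) (hφ t ht) i) (hza t ht)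
  · simp only [hzeq' t ht]
    exact MechanicalSystem.linearEquation_iff (hR t ht).2 (hφ t ht) c w
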